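/- Let $\mathfrak{B}_4\subset\mathbb{R}^3$ be the Bour minimal surface of value $4$, i.e. the set of all points $$\Bigl(\tfrac13u^3-uv^2-\tfrac15u^5+2u^3v^2-uv^4,\;\; -u^2v+\tfrac13v^3-u^4v+2u^2v^3-\tfrac15v^5,\;\; \tfrac12u^4-3u^2v^2+\tfrac12v^4\Bigr),\qquad u,v\in\mathbb{R}.$$ Say that $F\in\mathbb{R}[x,y,z]$ gives the irreducible implicit equation $F=0$ of a set $S\subset\mathbb{R}^3$ if $F$ is irreducible in $\mathbb{R}[x,y,z]$ and a polynomial in $\mathbb{R}[x,y,z]$ vanishes on $S$ if and only if it is a multiple of $F$; then $S$ is called algebraic of degree $\deg F$ (total degree). Then $\mathfrak{B}_4$ has an irreducible implicit equation $F=0$, where $F$ has integer coefficients, total degree $25$ and exactly $237$ non-zero terms, and $$\begin{aligned}F={}&1514571848868138319872\,z^{25}-9244212944751820800000\,x^4z^{20}+55465277668510924800000\,x^2y^2z^{20}\\&-9244212944751820800000\,y^4z^{20}-330069859172352000000000\,x^8z^{15}+R,\end{aligned}$$ where $R$ consists of the $232$ other terms, all of total degree at most $23$. In particular, $\mathfrak{B}_4$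 is algebraic of degree $25$. Moreover, $P(x,y,z)=2^{-20}F(2x,2y,2z)$ has integer coefficients, $P=0$ is the irreducible implicit equation of the homothetic surface $\tfrac12\mathfrak{B}_4$, $P$ has total degree $25$ and exactly $237$ terms, and $$\begin{aligned}P={}&48466299163780426235904\,z^{25}-147907407116029132800000\,x^4z^{20}+887444442696174796800000\,x^2y^2z^{20}\\&-147907407116029132800000\,y^4z^{20}-2640558873378816000000000\,x^8z^{15}+R',\end{aligned}$$ where $R'$ consists of the $232$ other terms, all of total degree at most $23$. -/

import Mathlib

/-- The parametrization of the Bour surface of value `4`. -/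
noncomputable def bour4 (u v : ℝ) : Fin 3 → ℝ :=
  ![u ^ 3 / 3 - u * v ^ 2 - u ^ 5 / 5 + 2 * u ^ 3 * v ^ 2 - u * v ^ 4,
    -(u ^ 2 * v) + v ^ 3 / 3 - u ^ 4 * v + 2 * u ^ 2 * v ^ 3 - v ^ 5 / 5,
    u ^ 4 / 2 - 3 * u ^ 2 * v ^ 2 + v ^ 4 / 2]

/-- The Bour surface of value `4`, as a subset of `ℝ³`. -/
def bour4Surface : Set (Fin 3 → ℝ) :=
  {p | ∃ u v : ℝ, p = bour4 u v}

/-- The homothetic copy of the Bour surface of value `4` with ratio `1 / 2`. -/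
def halfBour4Surface : Set (Fin 3 → ℝ) :=
  {p | ∃ u v : ℝ, p = (1 / 2 : ℝ) • bour4 u v}

/-- `F = 0` is the irreducible implicit equation of `S`: the polynomial `F` is irreducible, and
the polynomials that vanish on `S` are exactly the multiples of `F`
(so the roots of `F` form the Zariski closure of `S`). -/
def IsImplicitEquation (S : Set (Fin 3 → ℝ)) (F : MvPolynomial (Fin 3) ℝ) : Prop :=
  Irreducible F ∧
    ∀ G : MvPolynomial (Fin 3) ℝ, (∀ p ∈ S, MvPolynomial.eval p G = 0) ↔ F ∣ G

/-- `S` is algebraic of degree `n`: it has an irreducible implicit equation, of total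
degree `n`. -/
def IsAlgebraicOfDegree (S : Set (Fin 3 → ℝ)) (n : ℕ) : Prop :=
  ∃ F : MvPolynomial (Fin 3) ℝ, IsImplicitEquation S F ∧ F.totalDegree = n

/-! Put `w = u + iv`. Then `x + iy = conj(w)^3 / 3 - w^5 / 5` and `z = Re(w^4) / 2`. The proof has
two independent halves.

An explicit equation. The symmetries `w ↦ iw` and `w ↦ conj w` suggest using only `m = x^2 + y^2 =
|x + iy|^2`, `n = x^4 - 6x^2y^2 + y^4 = Re (x + iy)^4` and `z`. On the surface `m` and `n` are
polynomials in `z` and `p = |w|^2`, so that the explicit `F`, written in `m`, `n`, `z`, vanishes by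
a polynomial identity in only two variables `p`, `z` (`sum_bourInvariant_eq_zero`).

Minimality. No non-zero polynomial of degree less than 25 in `z` vanishes on the surface
(`eq_zero_of_vanishing_of_degree_lt`). For the weights 5, 5, 4 its leading part would vanish on the
leading part of the parametrization, where `x` and `y` depend only on `s^5` and `t^5` while `4z =
s^4 + t^4` (with `s = w`, `t = conj w` made independent over `ℂ`). The 25 choices of fifth roots
give 25 different values of `z`. Since `F` is a non-zero constant times `z^25` plus terms of lower
total degree, division by `F` shows that the vanishing ideal is `(F)`. This ideal is prime, being
the kernel of a map to a domain, so `F` is irreducible.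

The statements on terms and degrees are finite checks on the list of coefficients, and the scaled
surface follows by an automorphism of the polynomial ring. -/

/-! ### Vanishing on the surface as a polynomial identity -/

/-- The coordinates of `bour4` as polynomials in the two parameters. -/
noncomputable def bour4Poly : Fin 3 → MvPolynomial (Fin 2) ℝ :=
  let u : MvPolynomial (Fin 2) ℝ := MvPolynomial.X 0
  let v : MvPolynomial (Fin 2) ℝ := MvPolynomial.X 1
  ![MvPolynomial.C (1 / 3) * u ^ 3 - u * v ^ 2 - MvPolynomial.C (1 / 5) * u ^ 5 +
      2 * u ^ 3 * v ^ 2 - u * v ^ 4,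
    -(u ^ 2 * v) + MvPolynomial.C (1 / 3) * v ^ 3 - u ^ 4 * v + 2 * u ^ 2 * v ^ 3 -
      MvPolynomial.C (1 / 5) * v ^ 5,
    MvPolynomial.C (1 / 2) * u ^ 4 - 3 * u ^ 2 * v ^ 2 + MvPolynomial.C (1 / 2) * v ^ 4]

-- A real polynomial that is zero at all points is zero. This presents the vanishing ideal as the
-- kernel of a ring homomorphism to a domain, which gives both primality and the passage to complex
-- parameters.
open MvPolynomial in
theorem vanishing_iff_bind₁_eq_zero (r : MvPolynomial (Fin 3) ℝ) :
    (∀ p ∈ bour4Surface, eval p r = 0) ↔ bind₁ bour4Poly r = 0 := by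
  have key : ∀ a : Fin 2 → ℝ, eval a (bind₁ bour4Poly r) = eval (bour4 (a 0) (a 1)) r := by
    intro a
    change eval₂Hom (RingHom.id ℝ) a (bind₁ bour4Poly r) = _
    rw [eval₂Hom_bind₁]
    change eval _ r = _
    congr 2
    funext i
    fin_cases i <;> simp [bour4Poly, bour4] <;> ring
  constructor
  · intro hr
    refine MvPolynomial.funext fun a => ?_
    rw [key, map_zero]
    exact hr _ ⟨_, _, rfl⟩
  · rintro h _ ⟨u, v, rfl⟩
    refine (key ![u, v]).symm.trans ?_
    rw [h, map_zero]

open MvPolynomial in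
theorem eval_complex_eq_zero_of_vanishing {r : MvPolynomial (Fin 3) ℝ}
    (hr : ∀ p ∈ bour4Surface, eval p r = 0) (u v : ℂ) :
    eval ![u ^ 3 / 3 - u * v ^ 2 - u ^ 5 / 5 + 2 * u ^ 3 * v ^ 2 - u * v ^ 4,
      -(u ^ 2 * v) + v ^ 3 / 3 - u ^ 4 * v + 2 * u ^ 2 * v ^ 3 - v ^ 5 / 5,
      u ^ 4 / 2 - 3 * u ^ 2 * v ^ 2 + v ^ 4 / 2] (map (algebraMap ℝ ℂ) r) = 0 := by
  have h := congrArg (eval₂Hom (algebraMap ℝ ℂ) ![u, v]) ((vanishing_iff_bind₁_eq_zero r).1 hr)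
  rw [eval₂Hom_bind₁, map_zero] at h
  rw [eval_map, ← h]
  change _ = eval₂ _ _ r
  congr 1
  funext i
  fin_cases i <;> simp [bour4Poly] <;> ring

/-! ### Leading parts: no equation of degree less than 25 in `z` -/

open MvPolynomial in
/-- If a polynomial vanishes along a family of curves `h ↦ (h⁻ʷⁱ φᵢ(h))ᵢ`, its leading
part for the weights `w` vanishes at `φ(0)`. -/
theorem eval_weightedHomogeneousComponent_eq_zero {σ : Type*} [Fintype σ] (w : σ → ℕ)
    (r : MvPolynomial σ ℂ) (φ b : ℂ → σ → ℂ) (hφ : Continuous φ)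
    (hb : ∀ h, h ≠ 0 → eval (b h) r = 0) (hφb : ∀ h, h ≠ 0 → ∀ i, φ h i = h ^ w i * b h i) :
    eval (φ 0) (weightedHomogeneousComponent w (weightedTotalDegree w r) r) = 0 := by
  classical
  set N := weightedTotalDegree w r with hN
  have hle : ∀ c ∈ r.support, Finsupp.weight w c ≤ N := fun c hc => le_weightedTotalDegree w hc
  -- For `h ≠ 0` this is `h ^ N * eval (b h) r`, hence zero. Written through `φ` it has no negative
  -- powers of `h`, so it is continuous at 0, where only the terms of top weight survive.
  let g : ℂ → ℂ := fun h =>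
    ∑ c ∈ r.support, r.coeff c * (h ^ (N - Finsupp.weight w c) * ∏ i, φ h i ^ c i)
  have hg : Continuous g := by
    refine continuous_finsetSum _ fun c _ => continuous_const.mul
      ((continuous_pow _).mul (continuous_finsetProd _ fun i _ => ?_))
    exact ((continuous_apply i).comp hφ).pow _
  have hg0 : ∀ h, h ≠ 0 → g h = 0 := by
    intro h hh
    have : g h = h ^ N * eval (b h) r := by
      rw [eval_eq', Finset.mul_sum]
      refine Finset.sum_congr rfl fun c hc => ?_
      have h1 : ∏ i, φ h i ^ c i = h ^ Finsupp.weight w c * ∏ i, b h i ^ c i := by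
        rw [Finsupp.weight_apply, Finsupp.sum_fintype _ _ (by simp), ← Finset.prod_pow_eq_pow_sum,
          ← Finset.prod_mul_distrib]
        refine Finset.prod_congr rfl fun i _ => ?_
        rw [hφb h hh, mul_pow, smul_eq_mul, mul_comm (c i), pow_mul]
      rw [h1, ← pow_sub_mul_pow h (hle c hc)]
      ring
    rw [this, hb h hh, mul_zero]
  have hgz : g 0 = 0 := by
    have : g = fun _ => 0 :=
      hg.ext_on (dense_compl_singleton (0 : ℂ)) continuous_const fun h hh => hg0 h hh
    rw [this]
  refine Eq.trans ?_ hgz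
  rw [weightedHomogeneousComponent_apply, map_sum]
  simp only [g]
  rw [Finset.sum_filter]
  refine Finset.sum_congr rfl fun c hc => ?_
  split_ifs with h
  · rw [h, Nat.sub_self, pow_zero, one_mul, eval_monomial, Finsupp.prod_fintype _ _ (by simp)]
  · rw [zero_pow (Nat.sub_ne_zero_of_lt (lt_of_le_of_ne (hle c hc) h)), zero_mul, mul_zero]

-- Multiplying `s` and `t` by fifth roots of unity fixes the first two coordinates and moves the
-- third through 25 distinct values. A polynomial of degree less than 25 in the third variable
-- cannot have so many roots over the domain `ℂ[S, T]`.
open MvPolynomial in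
theorem eq_zero_of_eval_leading_eq_zero {r : MvPolynomial (Fin 3) ℂ}
    (hdeg : ∀ c ∈ r.support, c 2 < 25)
    (hr : ∀ s t : ℂ, eval ![-(s ^ 5 + t ^ 5) / 10, Complex.I * (s ^ 5 - t ^ 5) / 10,
      (s ^ 4 + t ^ 4) / 4] r = 0) : r = 0 := by
  let S : MvPolynomial (Fin 2) ℂ := X 0
  let T : MvPolynomial (Fin 2) ℂ := X 1
  let x : MvPolynomial (Fin 2) ℂ := C (-1 / 10) * (S ^ 5 + T ^ 5)
  let y : MvPolynomial (Fin 2) ℂ := C (Complex.I / 10) * (S ^ 5 - T ^ 5)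
  obtain ⟨ζ, hζ⟩ : ∃ ζ : ℂ, IsPrimitiveRoot ζ 5 :=
    ⟨_, Complex.isPrimitiveRoot_exp 5 (by norm_num)⟩
  let z : Fin 5 × Fin 5 → MvPolynomial (Fin 2) ℂ := fun k =>
    C (1 / 4) * (C ((ζ ^ (k.1 : ℕ)) ^ 4) * S ^ 4 + C ((ζ ^ (k.2 : ℕ)) ^ 4) * T ^ 4)
  have h5 : ∀ i : ℕ, (ζ ^ i) ^ 5 = 1 := fun i => by
    rw [← pow_mul, mul_comm, pow_mul, hζ.pow_eq_one, one_pow]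
  have hinj : ∀ i j : Fin 5, (ζ ^ (i : ℕ)) ^ 4 = (ζ ^ (j : ℕ)) ^ 4 → i = j := by
    intro i j h
    -- Both fifth powers are 1, so equal fourth powers force equal roots of unity.
    have hi := h5 i
    rw [pow_succ, h] at hi
    have hj := h5 j
    rw [pow_succ, ← hi] at hj
    have hne : (ζ ^ (j : ℕ)) ^ 4 ≠ 0 := by
      intro h0; rw [h0, zero_mul] at hi; exact zero_ne_one hi
    exact Fin.ext (hζ.pow_inj i.2 j.2 (mul_left_cancel₀ hne hj).symm)
  have hz : Function.Injective z := by
    intro k l h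
    refine Prod.ext (hinj _ _ ?_) (hinj _ _ ?_)
    · simpa [z, S, T] using congrArg (eval ![1, 0]) h
    · simpa [z, S, T] using congrArg (eval ![0, 1]) h
  -- `r` with its first two variables parametrized by `S`, `T` and the third left free; the `z k`
  -- are its 25 roots.
  let p : Polynomial (MvPolynomial (Fin 2) ℂ) :=
    aeval ![Polynomial.C x, Polynomial.C y, Polynomial.X] r
  have hpd : p.natDegree < 25 := by
    refine Nat.lt_succ_of_le ?_
    simp only [p]
    rw [aeval_def, eval₂_eq']
    refine Polynomial.natDegree_sum_le_of_forall_le _ _ fun c hc => ?_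
    rw [Fin.prod_univ_three]
    simp only [Matrix.cons_val_zero, Matrix.cons_val_one, Matrix.cons_val]
    rw [← Polynomial.C_pow, ← Polynomial.C_pow, ← Polynomial.C_mul,
      IsScalarTower.algebraMap_apply ℂ (MvPolynomial (Fin 2) ℂ), Polynomial.algebraMap_eq,
      ← mul_assoc, ← Polynomial.C_mul]
    exact (Polynomial.natDegree_C_mul_X_pow_le _ _).trans (Nat.le_of_lt_succ (hdeg c hc))
  have hp : p = 0 := by
    refine Polynomial.eq_zero_of_natDegree_lt_card_of_eval_eq_zero p hz (fun k => ?_)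
      (by simpa using hpd)
    refine MvPolynomial.funext fun a => ?_
    have : (eval a).comp ((Polynomial.evalRingHom (z k)).comp
        (aeval ![Polynomial.C x, Polynomial.C y, Polynomial.X] :
          MvPolynomial (Fin 3) ℂ →ₐ[ℂ] Polynomial (MvPolynomial (Fin 2) ℂ)).toRingHom) =
        eval ![-((ζ ^ (k.1 : ℕ) * a 0) ^ 5 + (ζ ^ (k.2 : ℕ) * a 1) ^ 5) / 10,
          Complex.I * ((ζ ^ (k.1 : ℕ) * a 0) ^ 5 - (ζ ^ (k.2 : ℕ) * a 1) ^ 5) / 10,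
          ((ζ ^ (k.1 : ℕ) * a 0) ^ 4 + (ζ ^ (k.2 : ℕ) * a 1) ^ 4) / 4] := by
      refine MvPolynomial.ringHom_ext (fun c => ?_) fun i => ?_
      · simp [IsScalarTower.algebraMap_apply ℂ (MvPolynomial (Fin 2) ℂ)
          (Polynomial (MvPolynomial (Fin 2) ℂ)), MvPolynomial.algebraMap_eq]
      · fin_cases i <;> simp [x, y, z, S, T, mul_pow, h5] <;> ring
    rw [map_zero]
    exact (congrArg (fun f => f r) this).trans (hr _ _)
  refine MvPolynomial.funext fun a => ?_
  -- Every point is reached: `x + iy = -s^5 / 5` and `x - iy = -t^5 / 5` are solvable for `s`, `t`.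
  -- So `p = 0` forces `r = 0`.
  obtain ⟨s, hs⟩ := IsAlgClosed.exists_pow_nat_eq (-5 * (a 0 + Complex.I * a 1)) (n := 5) (by norm_num)
  obtain ⟨t, ht⟩ := IsAlgClosed.exists_pow_nat_eq (-5 * (a 0 - Complex.I * a 1)) (n := 5) (by norm_num)
  have : (eval ![s, t]).comp ((Polynomial.evalRingHom (C (a 2))).comp
      (aeval ![Polynomial.C x, Polynomial.C y, Polynomial.X] :
        MvPolynomial (Fin 3) ℂ →ₐ[ℂ] Polynomial (MvPolynomial (Fin 2) ℂ)).toRingHom) = eval a := by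
    refine MvPolynomial.ringHom_ext (fun c => ?_) fun i => ?_
    · simp [IsScalarTower.algebraMap_apply ℂ (MvPolynomial (Fin 2) ℂ)
        (Polynomial (MvPolynomial (Fin 2) ℂ)), MvPolynomial.algebraMap_eq]
    · fin_cases i
      · simp [x, S, T, hs, ht]; ring
      · simp [y, S, T, hs, ht]; linear_combination (- a 1) * Complex.I_sq
      · simp
  rw [← this, map_zero]
  change eval ![s, t] (Polynomial.eval (C (a 2)) p) = 0
  rw [hp, Polynomial.eval_zero, map_zero]

open MvPolynomial in
theorem eq_zero_of_vanishing_of_degree_lt {r : MvPolynomial (Fin 3) ℝ}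
    (hr : ∀ p ∈ bour4Surface, eval p r = 0) (hdeg : ∀ c ∈ r.support, c 2 < 25) : r = 0 := by
  classical
  by_contra hne
  set q := map (algebraMap ℝ ℂ) r with hq
  have hinj := map_injective (σ := Fin 3) (algebraMap ℝ ℂ) (algebraMap ℝ ℂ).injective
  have hq0 : q ≠ 0 := fun h => hne (hinj (h.trans (map_zero _).symm))
  -- The degrees of the three coordinates in `u`, `v`.
  let w : Fin 3 → ℕ := ![5, 5, 4]
  obtain ⟨d, hd, hdw⟩ := Finset.exists_mem_eq_sup q.support (support_nonempty.2 hq0)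
    (fun c => Finsupp.weight w c)
  -- The monomial `d` attains the top weight, so the leading part of a non-zero `q` is non-zero.
  suffices h : weightedHomogeneousComponent w (weightedTotalDegree w q) q = 0 by
    have := congrArg (coeff d) h
    rw [coeff_weightedHomogeneousComponent, if_pos (by exact hdw.symm),
      coeff_zero] at this
    exact mem_support_iff.1 hd this
  refine eq_zero_of_eval_leading_eq_zero (fun c hc => ?_) fun s t => ?_
  · refine hdeg c ?_
    rw [mem_support_iff, coeff_weightedHomogeneousComponent] at hc
    rw [mem_support_iff]
    intro h0
    simp [hq, coeff_map, h0] at hc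
  -- Chosen so that `u + iv = s` and `u - iv = t`. The curve is the parametrization at `(u / h, v /
  -- h)`; after clearing denominators the cubic parts keep a factor `h ^ 2` and disappear at `h =
  -- 0`.
  · let u : ℂ := (s + t) / 2
    let v : ℂ := -Complex.I * (s - t) / 2
    have := eval_weightedHomogeneousComponent_eq_zero w q
      (fun h => ![h ^ 2 * (u ^ 3 / 3 - u * v ^ 2) - u ^ 5 / 5 + 2 * u ^ 3 * v ^ 2 - u * v ^ 4,
        h ^ 2 * (-(u ^ 2 * v) + v ^ 3 / 3) - u ^ 4 * v + 2 * u ^ 2 * v ^ 3 - v ^ 5 / 5,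
        u ^ 4 / 2 - 3 * u ^ 2 * v ^ 2 + v ^ 4 / 2]) _
      (by
        refine continuous_pi fun i => ?_
        fin_cases i <;> simp <;> fun_prop)
      (fun h _ => eval_complex_eq_zero_of_vanishing hr (u / h) (v / h))
      (fun h hh i => by
        fin_cases i <;> simp [w] <;> field_simp)
    convert this using 3
    have I3 : Complex.I ^ 3 = - Complex.I := by rw [pow_succ, Complex.I_sq]; ring
    have I5 : Complex.I ^ 5 = Complex.I := by
      rw [pow_succ, show (4 : ℕ) = 2 * 2 from rfl, pow_mul, Complex.I_sq]; ring
    have I4 : Complex.I ^ 4 = 1 := by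
      rw [show (4 : ℕ) = 2 * 2 from rfl, pow_mul, Complex.I_sq]; ring
    funext i
    fin_cases i <;> simp [u, v] <;> ring_nf <;> simp [I3, I4, I5] <;> ring

/-! ### From the leading term to the irreducible implicit equation -/

open MvPolynomial in
/-- A polynomial that vanishes on the Bour surface and whose leading form is a multiple of `z ^ 25`
is an irreducible implicit equation of it. -/
theorem isImplicitEquation_bour4Surface {F : MvPolynomial (Fin 3) ℝ}
    (hF : ∀ p ∈ bour4Surface, eval p F = 0) (hlead : F.coeff (Finsupp.single 2 25) ≠ 0)
    (hdeg : ∀ c ∈ F.support, c ≠ Finsupp.single 2 25 → c.degree < 25) :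
    IsImplicitEquation bour4Surface F := by
  have hd : MonomialOrder.degLex.degree F = Finsupp.single 2 25 := by
    apply MonomialOrder.degLex.toSyn.injective
    refine le_antisymm (MonomialOrder.degree_le_iff.2 fun c hc => ?_)
      (MonomialOrder.le_degree (mem_support_iff.2 hlead))
    by_cases h : c = Finsupp.single 2 25
    · rw [h]
    · rw [MonomialOrder.degLex_le_iff, Finsupp.DegLex.le_iff]
      left
      simpa using hdeg c hc h
  have hdvd : ∀ G : MvPolynomial (Fin 3) ℝ, (∀ p ∈ bour4Surface, eval p G = 0) → F ∣ G := by
    intro G hG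
    -- The leading coefficient is a unit, so the remainder exists and has no monomial divisible by
    -- `z^25`; it also vanishes on the surface.
    obtain ⟨g, r, hgr, -, hr⟩ := MonomialOrder.degLex.div_single
      (b := F) (by rw [MonomialOrder.leadingCoeff, hd]; exact isUnit_iff_ne_zero.2 hlead) G
    have hr0 : r = 0 := by
      refine eq_zero_of_vanishing_of_degree_lt (fun p hp => ?_) fun c hc => ?_
      · have := hG p hp
        rwa [hgr, map_add, map_mul, hF p hp, mul_zero, zero_add] at this
      · have := hr c hc
        rw [hd, Finsupp.single_le_iff] at this
        exact not_le.1 this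
    exact ⟨g, by rw [hgr, hr0, add_zero, mul_comm]⟩
  have hF0 : F ≠ 0 := fun h => hlead (by rw [h, coeff_zero])
  have hfac : ∀ G H : MvPolynomial (Fin 3) ℝ, F = G * H → F ∣ G → IsUnit H := by
    rintro G H h ⟨K, rfl⟩
    refine IsUnit.of_mul_eq_one K (mul_left_cancel₀ hF0 ?_)
    rw [mul_one]
    conv_rhs => rw [h]
    ring
  refine ⟨⟨fun h => ?_, fun G H h => ?_⟩, fun G => ⟨hdvd G, ?_⟩⟩
  · have := h.map (eval (bour4 0 0))
    rw [hF _ ⟨0, 0, rfl⟩] at this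
    exact not_isUnit_zero this
  -- One factor vanishes on the surface, as the target of `bind₁` is a domain. That factor is then a
  -- multiple of `F`, and the other one is a unit.
  · have hb := (vanishing_iff_bind₁_eq_zero F).1 hF
    rw [h, map_mul, mul_eq_zero] at hb
    rcases hb with hb | hb
    · exact Or.inr (hfac G H h (hdvd G ((vanishing_iff_bind₁_eq_zero G).2 hb)))
    · exact Or.inl (hfac H G (h.trans (mul_comm _ _))
        (hdvd H ((vanishing_iff_bind₁_eq_zero H).2 hb)))
  · rintro ⟨K, rfl⟩ p hp
    rw [map_mul, hF p hp, zero_mul]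

/-! ### Homotheties -/

/-- The homothety of ratio `c⁻¹`, on equations. -/
noncomputable def scaleEquiv (c : ℝˣ) : MvPolynomial (Fin 3) ℝ ≃ₐ[ℝ] MvPolynomial (Fin 3) ℝ :=
  AlgEquiv.ofAlgHom
    (MvPolynomial.aeval fun i => MvPolynomial.C (c : ℝ) * MvPolynomial.X i)
    (MvPolynomial.aeval fun i => MvPolynomial.C ((c⁻¹ : ℝˣ) : ℝ) * MvPolynomial.X i)
    (by ext1 i; simp [MvPolynomial.algHom_C, ← mul_assoc, ← MvPolynomial.C_mul])
    (by ext1 i; simp [MvPolynomial.algHom_C, ← mul_assoc, ← MvPolynomial.C_mul])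

open MvPolynomial in
theorem eval_scaleEquiv (c : ℝˣ) (p : Fin 3 → ℝ) (G : MvPolynomial (Fin 3) ℝ) :
    eval p (scaleEquiv c G) = eval ((c : ℝ) • p) G := by
  change eval p (aeval _ G) = _
  rw [← MvPolynomial.coe_aeval_eq_eval, ← MvPolynomial.coe_aeval_eq_eval]
  change ((aeval p).comp (aeval _)) G = aeval _ G
  congr 1
  ext1 i
  simp

-- Substituting `2X` is an automorphism, so it preserves irreducibility and divisibility, and it
-- carries the equations of the surface to those of its half. The constant `a` is a unit and does
-- not matter.
open MvPolynomial in
theorem IsImplicitEquation.halfBour4Surface {F P : MvPolynomial (Fin 3) ℝ} {a : ℝ} (ha : a ≠ 0)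
    (hF : IsImplicitEquation bour4Surface F)
    (hP : C a * P = aeval (fun i => C 2 * X i : Fin 3 → MvPolynomial (Fin 3) ℝ) F) :
    IsImplicitEquation halfBour4Surface P := by
  let σ := scaleEquiv (Units.mk0 2 two_ne_zero)
  have hσ : C a * P = σ F := hP
  have hu : IsUnit (C a : MvPolynomial (Fin 3) ℝ) := (isUnit_iff_ne_zero.2 ha).map C
  have hassoc : Associated P (σ F) := by
    rw [← hσ]; exact (associated_unit_mul_left _ _ hu).symm
  refine ⟨hassoc.symm.irreducible ((MulEquiv.irreducible_iff σ).2 hF.1), fun G => ?_⟩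
  rw [hassoc.dvd_iff_dvd_left]
  obtain ⟨H, rfl⟩ := σ.surjective G
  rw [map_dvd_iff, ← hF.2]
  constructor
  · rintro h _ ⟨u, v, rfl⟩
    have := h _ ⟨u, v, rfl⟩
    rw [eval_scaleEquiv, smul_smul] at this
    simpa using this
  · rintro h _ ⟨u, v, rfl⟩
    rw [eval_scaleEquiv, smul_smul]
    simpa using h _ ⟨u, v, rfl⟩

/-! ### Polynomials given by lists of terms -/

/-- The monomial `x ^ a * y ^ b * z ^ c` as an exponent vector, for the triple `(a, b, c)`. -/
noncomputable def tripleExponent (e : ℕ × ℕ × ℕ) : Fin 3 →₀ ℕ :=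
  Finsupp.equivFunOnFinite.symm ![e.1, e.2.1, e.2.2]

theorem tripleExponent_injective : Function.Injective tripleExponent := by
  rintro ⟨a, b, c⟩ ⟨a', b', c'⟩ h
  have := Finsupp.equivFunOnFinite.symm.injective h
  simpa using this

theorem degree_tripleExponent (e : ℕ × ℕ × ℕ) :
    (tripleExponent e).degree = e.1 + e.2.1 + e.2.2 := by
  simp [Finsupp.degree_eq_sum, Fin.sum_univ_three, tripleExponent]

/-- The polynomial with the given list of coefficients and exponents. -/
noncomputable def ofTerms (L : List (ℤ × ℕ × ℕ × ℕ)) : MvPolynomial (Fin 3) ℤ :=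
  (L.map fun t => MvPolynomial.monomial (tripleExponent t.2) t.1).sum

theorem ofTerms_cons (t : ℤ × ℕ × ℕ × ℕ) (L : List (ℤ × ℕ × ℕ × ℕ)) :
    ofTerms (t :: L) = MvPolynomial.monomial (tripleExponent t.2) t.1 + ofTerms L := rfl

theorem ofTerms_eq_filter_add_filter_not (p : ℤ × ℕ × ℕ × ℕ → Bool)
    (L : List (ℤ × ℕ × ℕ × ℕ)) :
    ofTerms L = ofTerms (L.filter p) + ofTerms (L.filter fun t => !p t) := by
  induction L with
  | nil => simp [ofTerms]
  | cons t L ih =>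
    cases h : p t <;> simp only [List.filter_cons, h, ofTerms_cons, ih] <;> simp [ofTerms_cons] <;>
      ring

open MvPolynomial in
theorem eval_map_ofTerms (p : Fin 3 → ℝ) (L : List (ℤ × ℕ × ℕ × ℕ)) :
    eval p (map (Int.castRingHom ℝ) (ofTerms L)) =
      (L.map fun t => (t.1 : ℝ) * p 0 ^ t.2.1 * p 1 ^ t.2.2.1 * p 2 ^ t.2.2.2).sum := by
  induction L with
  | nil => simp [ofTerms]
  | cons t L ih =>
    rw [ofTerms_cons, map_add, map_add, ih, List.map_cons, List.sum_cons]
    simp [map_monomial, eval_monomial, Finsupp.prod_fintype, Fin.prod_univ_three, tripleExponent,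
      mul_assoc]

theorem exists_mem_of_mem_support_ofTerms {L : List (ℤ × ℕ × ℕ × ℕ)} {m : Fin 3 →₀ ℕ}
    (hm : m ∈ (ofTerms L).support) : ∃ t ∈ L, tripleExponent t.2 = m := by
  classical
  induction L with
  | nil => simp [ofTerms] at hm
  | cons t L ih =>
    rw [ofTerms_cons] at hm
    rcases Finset.mem_union.1 (MvPolynomial.support_add hm) with h | h
    · exact ⟨t, List.mem_cons_self, (Finset.mem_singleton.1
        (MvPolynomial.support_monomial_subset h)).symm⟩
    · obtain ⟨s, hs, h⟩ := ih h
      exact ⟨s, List.mem_cons_of_mem _ hs, h⟩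

theorem coeff_ofTerms_eq_zero {L : List (ℤ × ℕ × ℕ × ℕ)} {e : ℕ × ℕ × ℕ}
    (he : ∀ t ∈ L, t.2 ≠ e) : (ofTerms L).coeff (tripleExponent e) = 0 := by
  by_contra h
  obtain ⟨t, ht, h⟩ := exists_mem_of_mem_support_ofTerms (MvPolynomial.mem_support_iff.2 h)
  exact he t ht (tripleExponent_injective h)

theorem coeff_ofTerms {L : List (ℤ × ℕ × ℕ × ℕ)} (hL : (L.map Prod.snd).Nodup)
    {t : ℤ × ℕ × ℕ × ℕ} (ht : t ∈ L) : (ofTerms L).coeff (tripleExponent t.2) = t.1 := by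
  classical
  induction L with
  | nil => simp at ht
  | cons s L ih =>
    rw [List.map_cons, List.nodup_cons] at hL
    rw [ofTerms_cons, MvPolynomial.coeff_add, MvPolynomial.coeff_monomial]
    rcases List.mem_cons.1 ht with rfl | ht
    · rw [if_pos rfl, coeff_ofTerms_eq_zero, add_zero]
      exact fun u hu h => hL.1 (h ▸ List.mem_map_of_mem hu)
    · rw [if_neg, zero_add, ih hL.2 ht]
      exact fun h => hL.1 (tripleExponent_injective h ▸ List.mem_map_of_mem ht)

theorem card_support_ofTerms {L : List (ℤ × ℕ × ℕ × ℕ)} (hL : (L.map Prod.snd).Nodup)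
    (h0 : ∀ t ∈ L, t.1 ≠ 0) : (ofTerms L).support.card = L.length := by
  classical
  have : (ofTerms L).support = ((L.map Prod.snd).map tripleExponent).toFinset := by
    ext m
    constructor
    · intro hm
      obtain ⟨t, ht, h⟩ := exists_mem_of_mem_support_ofTerms hm
      simp only [List.mem_toFinset, List.mem_map]
      exact ⟨t.2, ⟨t, ht, rfl⟩, h⟩
    · simp only [List.mem_toFinset, List.mem_map]
      rintro ⟨_, ⟨t, ht, rfl⟩, rfl⟩
      rw [MvPolynomial.mem_support_iff, coeff_ofTerms hL ht]
      exact h0 t ht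
  rw [this, List.toFinset_card_of_nodup (hL.map tripleExponent_injective), List.length_map,
    List.length_map]

theorem totalDegree_ofTerms_le {L : List (ℤ × ℕ × ℕ × ℕ)} {d : ℕ}
    (hd : ∀ t ∈ L, t.2.1 + t.2.2.1 + t.2.2.2 ≤ d) : (ofTerms L).totalDegree ≤ d := by
  refine Finset.sup_le fun m hm => ?_
  obtain ⟨t, ht, rfl⟩ := exists_mem_of_mem_support_ofTerms hm
  change (tripleExponent t.2).degree ≤ d
  rw [degree_tripleExponent]
  exact hd t ht

theorem totalDegree_ofTerms {L : List (ℤ × ℕ × ℕ × ℕ)} {d : ℕ} (hL : (L.map Prod.snd).Nodup)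
    (h0 : ∀ t ∈ L, t.1 ≠ 0) (hd : ∀ t ∈ L, t.2.1 + t.2.2.1 + t.2.2.2 ≤ d)
    (hd' : ∃ t ∈ L, t.2.1 + t.2.2.1 + t.2.2.2 = d) : (ofTerms L).totalDegree = d := by
  refine le_antisymm (totalDegree_ofTerms_le hd) ?_
  obtain ⟨t, ht, rfl⟩ := hd'
  rw [← degree_tripleExponent]
  exact MvPolynomial.le_totalDegree (MvPolynomial.mem_support_iff.2
    (by rw [coeff_ofTerms hL ht]; exact h0 t ht))

/-- The terms of `2 ^ (-20) * F(2x, 2y, 2z)`, from those of `F`. -/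
def halveTerm (t : ℤ × ℕ × ℕ × ℕ) : ℤ × ℕ × ℕ × ℕ :=
  -- This is integer division; its exactness on the terms of `F` is `halveTerm_bourTerms`.
  (t.1 * 2 ^ (t.2.1 + t.2.2.1 + t.2.2.2) / 2 ^ 20, t.2)

open MvPolynomial in
theorem C_mul_ofTerms_map_halveTerm {L : List (ℤ × ℕ × ℕ × ℕ)}
    (h : ∀ t ∈ L, (halveTerm t).1 * 2 ^ 20 = t.1 * 2 ^ (t.2.1 + t.2.2.1 + t.2.2.2)) :
    C (2 ^ 20) * ofTerms (L.map halveTerm) =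
      aeval (fun i : Fin 3 => (2 * X i : MvPolynomial (Fin 3) ℤ)) (ofTerms L) := by
  induction L with
  | nil => simp [ofTerms]
  | cons t L ih =>
    rw [List.map_cons, ofTerms_cons, ofTerms_cons, map_add, mul_add,
      ih fun s hs => h s (List.mem_cons_of_mem _ hs), aeval_monomial]
    congr 1
    rw [C_mul_monomial, mul_comm, h t List.mem_cons_self]
    simp only [mul_pow, Finsupp.prod_mul]
    rw [monomial_eq]
    simp only [Finsupp.prod_fintype, Fin.prod_univ_three, pow_zero, implies_true, halveTerm,
      tripleExponent, Finsupp.coe_equivFunOnFinite_symm]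
    simp [pow_add]
    ring

open MvPolynomial in
theorem ofTerms_leading (a b c d e : ℤ) :
    ofTerms [(-e, 8, 0, 15), (-b, 4, 0, 20), (c, 2, 2, 20), (-d, 0, 4, 20), (a, 0, 0, 25)] =
      C a * X 2 ^ 25 - C b * X 0 ^ 4 * X 2 ^ 20 + C c * X 0 ^ 2 * X 1 ^ 2 * X 2 ^ 20
        - C d * X 1 ^ 4 * X 2 ^ 20 - C e * X 0 ^ 8 * X 2 ^ 15 := by
  simp only [ofTerms, List.map_cons, List.map_nil, List.sum_cons, List.sum_nil, monomial_eq,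
    Finsupp.prod_fintype, Fin.prod_univ_three, pow_zero, implies_true,
    tripleExponent, Finsupp.coe_equivFunOnFinite_symm]
  simp
  ring

/-! ### The explicit equation and its vanishing on the surface -/

/-- The terms of the implicit equation of the Bour surface: for every power `z ^ c`, the
coefficients and exponents of its coefficient in `x` and `y`. -/
def bourCoefficients : List (ℕ × List (ℤ × ℕ × ℕ)) :=
  [ (0, [
      (-4105255222320556640625, 20, 0), (123157656669616699218750, 18, 2),
      (-1498418156147003173828125, 16, 4), (9359981906890869140625000, 14, 6),
      (-31076782032966613769531250, 12, 8), (50396113109207153320312500, 10, 10),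
      (-31076782032966613769531250, 8, 12), (9359981906890869140625000, 6, 14),
      (-1498418156147003173828125, 4, 16), (123157656669616699218750, 2, 18),
      (-4105255222320556640625, 0, 20)]),
    (2, [
      (-109473472595214843750000, 18, 0), (1642102088928222656250000, 16, 2),
      (-6568408355712890625000000, 14, 4), (-3065257232666015625000000, 12, 6),
      (36126245956420898437500000, 10, 8), (36126245956420898437500000, 8, 10),
      (-3065257232666015625000000, 6, 12), (-6568408355712890625000000, 4, 14),
      (1642102088928222656250000, 2, 16), (-109473472595214843750000, 0, 18)]),
    (3, [
      (-6081859588623046875000, 16, 0), (-29192926025390625000000, 14, 2),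
      (1114196676635742187500000, 12, 4), (-5342305462646484375000000, 10, 6),
      (6969811088562011718750000, 8, 8), (-5342305462646484375000000, 6, 10),
      (1114196676635742187500000, 4, 12), (-29192926025390625000000, 2, 14),
      (-6081859588623046875000, 0, 16)]),
    (4, [
      (-1158959163208007812500000, 16, 0), (8033893242187500000000000, 14, 2),
      (-25024176188964843750000000, 12, 4), (66139493203125000000000000, 10, 6),
      (200713043594970703125000000, 8, 8), (66139493203125000000000000, 6, 10),
      (-25024176188964843750000000, 4, 12), (8033893242187500000000000, 2, 14),
      (-1158959163208007812500000, 0, 16)]),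
    (5, [
      (-134936191406250000000000, 14, 0), (148183292504882812500000, 16, 0),
      (-1774929902343750000000000, 12, 2), (9054945022851562500000000, 14, 2),
      (-3664036582031250000000000, 10, 4), (24192761655761718750000000, 12, 4),
      (-3062013574218750000000000, 8, 6), (-16789902702539062500000000, 10, 6),
      (-3062013574218750000000000, 6, 8), (4722948344091796875000000, 8, 8),
      (-3664036582031250000000000, 4, 10), (-16789902702539062500000000, 6, 10),
      (-1774929902343750000000000, 2, 12), (24192761655761718750000000, 4, 12),
      (-134936191406250000000000, 0, 14), (9054945022851562500000000, 2, 14),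
      (148183292504882812500000, 0, 16)]),
    (6, [
      (-1922167968750000000000, 12, 0), (-6272664553125000000000000, 14, 0),
      (34599023437500000000000, 10, 2), (18947532403125000000000000, 12, 2),
      (-213360644531250000000000, 8, 4), (30456551559375000000000000, 10, 4),
      (484386328125000000000000, 6, 6), (358319111990625000000000000, 8, 6),
      (-213360644531250000000000, 4, 8), (358319111990625000000000000, 6, 8),
      (34599023437500000000000, 2, 10), (30456551559375000000000000, 4, 10),
      (-1922167968750000000000, 0, 12), (18947532403125000000000000, 2, 12),
      (-6272664553125000000000000, 0, 14)]),
    (7, [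
      (-1108091390625000000000000, 12, 0), (2286857053125000000000000, 14, 0),
      (-13365372093750000000000000, 10, 2), (69098955271875000000000000, 12, 2),
      (-16621370859375000000000000, 8, 4), (101114954015625000000000000, 10, 4),
      (-8728180312500000000000000, 6, 6), (-26141914940625000000000000, 8, 6),
      (-16621370859375000000000000, 4, 8), (-26141914940625000000000000, 6, 8),
      (-13365372093750000000000000, 2, 10), (101114954015625000000000000, 4, 10),
      (-1108091390625000000000000, 0, 12), (69098955271875000000000000, 2, 12),
      (2286857053125000000000000, 0, 14)]),
    (8, [
      (-32805000000000000000000, 10, 0), (-18667861576875000000000000, 12, 0),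
      (98415000000000000000000, 8, 2), (44095652673750000000000000, 10, 2),
      (459270000000000000000000, 6, 4), (263274210646875000000000000, 8, 4),
      (459270000000000000000000, 4, 6), (617339137432500000000000000, 6, 6),
      (98415000000000000000000, 2, 8), (263274210646875000000000000, 4, 8),
      (-32805000000000000000000, 0, 10), (44095652673750000000000000, 2, 10),
      (-18667861576875000000000000, 0, 12)]),
    (9, [
      (253125000000000000000, 8, 0), (-4204288800000000000000000, 10, 0),
      (12043515942000000000000000, 12, 0), (-3037500000000000000000, 6, 2),
      (-33366621600000000000000000, 8, 2), (189501231780000000000000000, 10, 2),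
      (9618750000000000000000, 4, 4), (-29697710400000000000000000, 6, 4),
      (180652739130000000000000000, 8, 4), (-3037500000000000000000, 2, 6),
      (-29697710400000000000000000, 4, 6), (6390046584000000000000000, 6, 6),
      (253125000000000000000, 0, 8), (-33366621600000000000000000, 2, 8),
      (180652739130000000000000000, 4, 8), (-4204288800000000000000000, 0, 10),
      (189501231780000000000000000, 2, 10), (12043515942000000000000000, 0, 12)]),
    (10, [
      (-175324500000000000000000, 8, 0), (-30513216456000000000000000, 10, 0),
      (-1318951531440000000000000, 12, 0), (701298000000000000000000, 6, 2),
      (91539649368000000000000000, 8, 2), (3078701485920000000000000, 10, 2),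
      (1753245000000000000000000, 4, 4), (427185030384000000000000000, 6, 4),
      (18895788650160000000000000, 8, 4), (701298000000000000000000, 2, 6),
      (427185030384000000000000000, 4, 6), (43101820802880000000000000, 6, 6),
      (-175324500000000000000000, 0, 8), (91539649368000000000000000, 2, 8),
      (18895788650160000000000000, 4, 8), (-30513216456000000000000000, 0, 10),
      (3078701485920000000000000, 2, 10), (-1318951531440000000000000, 0, 12)]),
    (11, [
      (4320000000000000000000, 6, 0), (-7800635340000000000000000, 8, 0),
      (28221302741760000000000000, 10, 0), (12960000000000000000000, 4, 2),
      (-38038578480000000000000000, 6, 2), (247094045648640000000000000, 8, 2),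
      (12960000000000000000000, 2, 4), (-33131737800000000000000000, 4, 4),
      (176225495477760000000000000, 6, 4), (4320000000000000000000, 0, 6),
      (-38038578480000000000000000, 2, 6), (176225495477760000000000000, 4, 6),
      (-7800635340000000000000000, 0, 8), (247094045648640000000000000, 2, 8),
      (28221302741760000000000000, 0, 10)]),
    (12, [
      (-301708800000000000000000, 6, 0), (-26627792256000000000000000, 8, 0),
      (-5363047480320000000000000, 10, 0), (1508544000000000000000000, 4, 2),
      (106511169024000000000000000, 6, 2), (16089142440960000000000000, 8, 2),
      (1508544000000000000000000, 2, 4), (266277922560000000000000000, 4, 4),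
      (75082664724480000000000000, 6, 4), (-301708800000000000000000, 0, 6),
      (106511169024000000000000000, 2, 6), (75082664724480000000000000, 4, 6),
      (-26627792256000000000000000, 0, 8), (16089142440960000000000000, 2, 8),
      (-5363047480320000000000000, 0, 10)]),
    (13, [
      (23040000000000000000000, 4, 0), (-7302970368000000000000000, 6, 0),
      (32842747689984000000000000, 8, 0), (46080000000000000000000, 2, 2),
      (-21908911104000000000000000, 4, 2), (164266525421568000000000000, 6, 2),
      (23040000000000000000000, 0, 4), (-21908911104000000000000000, 2, 4),
      (131265416816640000000000000, 4, 4), (-7302970368000000000000000, 0, 6),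
      (164266525421568000000000000, 2, 6), (32842747689984000000000000, 0, 8)]),
    (14, [
      (-162570240000000000000000, 4, 0), (-11369253519360000000000000, 6, 0),
      (-7554305418854400000000000, 8, 0), (975421440000000000000000, 2, 2),
      (56846267596800000000000000, 4, 2), (30217221675417600000000000, 6, 2),
      (-162570240000000000000000, 0, 4), (56846267596800000000000000, 2, 4),
      (75543054188544000000000000, 4, 4), (-11369253519360000000000000, 0, 6),
      (30217221675417600000000000, 2, 6), (-7554305418854400000000000, 0, 8)]),
    (15, [
      (39321600000000000000000, 2, 0), (-3377745100800000000000000, 4, 0),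
      (19341436649472000000000000, 6, 0), (-330069859172352000000000, 8, 0),
      (39321600000000000000000, 0, 2), (-6755490201600000000000000, 2, 2),
      (58024309948416000000000000, 4, 2), (-1681381504843776000000000, 6, 2),
      (-3377745100800000000000000, 0, 4), (58024309948416000000000000, 2, 4),
      (-1258215018725376000000000, 4, 4), (19341436649472000000000000, 0, 6),
      (-1681381504843776000000000, 2, 6), (-330069859172352000000000, 0, 8)]),
    (16, [
      (-1847201366016000000000000, 4, 0), (-4269697602158592000000000, 6, 0),
      (11083208196096000000000000, 2, 2), (21348488010792960000000000, 4, 2),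
      (-1847201366016000000000000, 0, 4), (21348488010792960000000000, 2, 4),
      (-4269697602158592000000000, 0, 6)]),
    (17, [
      (20971520000000000000000, 0, 0), (-713451110400000000000000, 2, 0),
      (5544080792616960000000000, 4, 0), (-842571492360192000000000, 6, 0),
      (-713451110400000000000000, 0, 2), (11088161585233920000000000, 2, 2),
      (-2527714477080576000000000, 4, 2), (5544080792616960000000000, 0, 4),
      (-2527714477080576000000000, 2, 4), (-842571492360192000000000, 0, 6)]),
    (18, [
      (-806907090567168000000000, 4, 0), (4841442543403008000000000, 2, 2),
      (-806907090567168000000000, 0, 4)]),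
    (19, [
      (-43486543872000000000000, 0, 0), (708004420780032000000000, 2, 0),
      (-654798416919920640000000, 4, 0), (708004420780032000000000, 0, 2),
      (-1309596833839841280000000, 2, 2), (-654798416919920640000000, 0, 4)]),
    (20, [
      (-9244212944751820800000, 4, 0), (55465277668510924800000, 2, 2),
      (-9244212944751820800000, 0, 4)]),
    (21, [
      (33815136514867200000000, 0, 0), (-180775719808480051200000, 2, 0),
      (-180775719808480051200000, 0, 2)]),
    (23, [
      (-11686511179538104320000, 0, 0)]),
    (25, [
      (1514571848868138319872, 0, 0)])]

/-- The terms of the implicit equation of the Bour surface. -/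
def bourTerms : List (ℤ × ℕ × ℕ × ℕ) :=
  bourCoefficients.flatMap fun k => k.2.map fun t => (t.1, t.2.1, t.2.2, k.1)

/-- The coefficients of the powers of `z` in terms of `m = x ^ 2 + y ^ 2` and
`n = x ^ 4 - 6 * x ^ 2 * y ^ 2 + y ^ 4`. -/
def bourInvariant (m n z : ℝ) : List ℝ :=
  [ (-4105255222320556640625 * n ^ 5) * z ^ 0,
    (-109473472595214843750000 * m ^ 3 * n ^ 3) * z ^ 2,
    (4865487670898437500000 * n ^ 4 - 10947347259521484375000 * m ^ 4 * n ^ 2) * z ^ 3,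
    (-502118327636718750000000 * m ^ 2 * n ^ 3 - 656840835571289062500000 * m ^ 6 * n) * z ^ 4,
    (16815125390625000000000 * n ^ 4 + 51898535156250000000000 * m ^ 3 * n ^ 2 -
        525472668457031250000000 * m ^ 4 * n ^ 2 - 186834726562500000000000 * m ^ 7 +
        656840835571289062500000 * m ^ 8) * z ^ 5,
    (-1922167968750000000000 * n ^ 3 - 792179240625000000000000 * m * n ^ 3 -
        5480485312500000000000000 * m ^ 5 * n) * z ^ 6,
    (419801484375000000000000 * m ^ 2 * n ^ 2 -
        3318184743750000000000000 * m ^ 3 * n ^ 2 - 1527892875000000000000000 * m ^ 6 +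
        5605041796875000000000000 * m ^ 7) * z ^ 7,
    (-422495595000000000000000 * n ^ 3 - 32805000000000000000000 * m ^ 3 * n -
        18245365981875000000000000 * m ^ 4 * n) * z ^ 8,
    (253125000000000000000 * n ^ 2 + 771573600000000000000000 * m * n ^ 2 -
        7327508508000000000000000 * m ^ 2 * n ^ 2 - 4975862400000000000000000 * m ^ 5 +
        19371024450000000000000000 * m ^ 6) * z ^ 9,
    (-27549901440000000000000 * n ^ 3 - 175324500000000000000000 * m ^ 2 * n -
        30513216456000000000000000 * m ^ 3 * n - 1291401630000000000000000 * m ^ 4 * n) * z ^ 10,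
    (427252320000000000000000 * n ^ 2 - 6624220746240000000000000 * m * n ^ 2 +
        4320000000000000000000 * m ^ 3 - 8227887660000000000000000 * m ^ 4 +
        34845523488000000000000000 * m ^ 5) * z ^ 11,
    (-301708800000000000000000 * m * n - 26627792256000000000000000 * m ^ 2 * n -
        5363047480320000000000000 * m ^ 3 * n) * z ^ 12,
    (-2055970916352000000000000 * n ^ 2 + 23040000000000000000000 * m ^ 2 -
        7302970368000000000000000 * m ^ 3 + 34898718606336000000000000 * m ^ 4) * z ^ 13,
    (-162570240000000000000000 * n - 11369253519360000000000000 * m * n -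
        7554305418854400000000000 * m ^ 2 * n) * z ^ 14,
    (22568879259648000000000 * n ^ 2 + 39321600000000000000000 * m -
        3377745100800000000000000 * m ^ 2 + 19341436649472000000000000 * m ^ 3 -
        352638738432000000000000 * m ^ 4) * z ^ 15,
    (-1847201366016000000000000 * n - 4269697602158592000000000 * m * n) * z ^ 16,
    (20971520000000000000000 - 713451110400000000000000 * m +
        5544080792616960000000000 * m ^ 2 - 842571492360192000000000 * m ^ 3) * z ^ 17,
    (-806907090567168000000000 * n) * z ^ 18,
    (-43486543872000000000000 + 708004420780032000000000 * m -
        654798416919920640000000 * m ^ 2) * z ^ 19,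
    (-9244212944751820800000 * n) * z ^ 20,
    (33815136514867200000000 - 180775719808480051200000 * m) * z ^ 21,
    (-11686511179538104320000) * z ^ 23,
    (1514571848868138319872) * z ^ 25]

theorem map_bourCoefficients (x y z : ℝ) :
    bourCoefficients.map (fun k =>
        (k.2.map fun t => (t.1 : ℝ) * x ^ t.2.1 * y ^ t.2.2).sum * z ^ k.1) =
      bourInvariant (x ^ 2 + y ^ 2) (x ^ 4 - 6 * x ^ 2 * y ^ 2 + y ^ 4) z := by
  simp only [bourCoefficients, bourInvariant, List.map_cons, List.map_nil, List.sum_cons,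
    List.sum_nil, List.cons.injEq, and_true]
  push_cast
  and_intros <;> ring

/-- Here `p` stands for `|w|^2`. Expanding `|x + iy|^2` and `Re (x + iy)^4` leaves only powers of
`|w|^2` and real parts of `w^4`, `w^8`, `w^12`, `w^20`, which are polynomials in `Re(w^4) = 2z` and
`|w|^8 = p^4`. For example `Re(w^8) = 8z^2 - p^4` gives the cross term of `m`. -/
theorem sum_bourInvariant_eq_zero {p m n z : ℝ}
    (hm : m = p ^ 3 / 9 + 2 * p ^ 4 / 15 + p ^ 5 / 25 - 16 * z ^ 2 / 15)
    (hn : n = (64 * z ^ 3 - 12 * p ^ 4 * z) / 162 - 8 * p ^ 5 * z / 135 + 12 * p ^ 6 * z / 225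
      - 2 * p ^ 3 * (64 * z ^ 3 - 12 * p ^ 4 * z) / 375
      + (1024 * z ^ 5 - 320 * p ^ 4 * z ^ 3 + 20 * p ^ 8 * z) / 1250) :
    (bourInvariant m n z).sum = 0 := by
  simp only [bourInvariant, List.sum_cons, List.sum_nil]
  subst hm hn
  ring

theorem eval_bourTerms {p : Fin 3 → ℝ} (hp : p ∈ bour4Surface) :
    MvPolynomial.eval p (MvPolynomial.map (Int.castRingHom ℝ) (ofTerms bourTerms)) = 0 := by
  obtain ⟨u, v, rfl⟩ := hp
  rw [eval_map_ofTerms, bourTerms, List.map_flatMap, List.flatMap_def, List.sum_flatten,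
    List.map_map]
  refine Eq.trans ?_ (sum_bourInvariant_eq_zero (p := u ^ 2 + v ^ 2) (z := bour4 u v 2)
    (m := bour4 u v 0 ^ 2 + bour4 u v 1 ^ 2)
    (n := bour4 u v 0 ^ 4 - 6 * bour4 u v 0 ^ 2 * bour4 u v 1 ^ 2 + bour4 u v 1 ^ 4) ?_ ?_)
  · rw [← map_bourCoefficients]
    congr 2
    funext k
    rw [← List.sum_map_mul_right, Function.comp_apply, List.map_map]
    rfl
  · simp [bour4]
    ring
  · simp [bour4]
    ring

/-! ### Finite checks on the list of terms -/

/-- The five terms that the statement of the main theorem displays. -/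
def isDisplayed (t : ℤ × ℕ × ℕ × ℕ) : Bool :=
  -- The exponent `(8, 0, 15)` has degree 23, so a bound on the degree does not separate it from the
  -- remainder.
  decide (23 < t.2.1 + t.2.2.1 + t.2.2.2) || decide (t.2 = (8, 0, 15))

/-- Encoding exponents as integers in base 32 makes the list strictly increasing, so comparing
neighbours suffices. Injectivity of the encoding is not needed: distinct images have distinct
preimages. -/
theorem nodup_bourTerms : (bourTerms.map Prod.snd).Nodup := by
  refine List.Nodup.of_map (fun e : ℕ × ℕ × ℕ => e.1 + 32 * e.2.1 + 1024 * e.2.2) ?_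
  have h : (((bourTerms.map Prod.snd).map
      fun e : ℕ × ℕ × ℕ => e.1 + 32 * e.2.1 + 1024 * e.2.2)).IsChain (· < ·) := by
    decide +kernel
  exact (List.isChain_iff_pairwise.1 h).imp fun hab => hab.ne

theorem bourTerms_ne_zero : ∀ t ∈ bourTerms, t.1 ≠ 0 := by decide +kernel

theorem degree_bourTerms_le : ∀ t ∈ bourTerms, t.2.1 + t.2.2.1 + t.2.2.2 ≤ 25 := by
  decide +kernel

theorem halveTerm_bourTerms : ∀ t ∈ bourTerms,
    (halveTerm t).1 * 2 ^ 20 = t.1 * 2 ^ (t.2.1 + t.2.2.1 + t.2.2.2) := by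
  decide +kernel

theorem halveTerm_bourTerms_ne_zero : ∀ t ∈ bourTerms.map halveTerm, t.1 ≠ 0 := by
  intro s hs
  obtain ⟨t, ht, rfl⟩ := List.mem_map.1 hs
  intro h
  have := halveTerm_bourTerms t ht
  rw [h, zero_mul] at this
  exact mul_ne_zero (bourTerms_ne_zero t ht) (pow_ne_zero _ two_ne_zero) this.symm

theorem map_snd_map_halveTerm (L : List (ℤ × ℕ × ℕ × ℕ)) :
    (L.map halveTerm).map Prod.snd = L.map Prod.snd := by
  rw [List.map_map]
  rfl

theorem filter_bourTerms : bourTerms.filter isDisplayed =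
    [(-330069859172352000000000, 8, 0, 15), (-9244212944751820800000, 4, 0, 20),
      (55465277668510924800000, 2, 2, 20), (-9244212944751820800000, 0, 4, 20),
      (1514571848868138319872, 0, 0, 25)] := by
  decide +kernel

theorem filter_halveTerm_bourTerms : (bourTerms.map halveTerm).filter isDisplayed =
    [(-2640558873378816000000000, 8, 0, 15), (-147907407116029132800000, 4, 0, 20),
      (887444442696174796800000, 2, 2, 20), (-147907407116029132800000, 0, 4, 20),
      (48466299163780426235904, 0, 0, 25)] := by
  decide +kernel

theorem length_bourTerms : bourTerms.length = 237 := by decide +kernel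

/-- The remainder after the displayed terms. -/
theorem exists_remainder {L : List (ℤ × ℕ × ℕ × ℕ)} (hL : (L.map Prod.snd).Nodup)
    (h0 : ∀ t ∈ L, t.1 ≠ 0) (hlen : L.length = 237) (hf : (L.filter isDisplayed).length = 5) :
    ∃ R : MvPolynomial (Fin 3) ℤ, ofTerms L = ofTerms (L.filter isDisplayed) + R ∧
      R.totalDegree ≤ 23 ∧ R.coeff (Finsupp.single 0 8 + Finsupp.single 2 15) = 0 ∧
      R.support.card = 232 := by
  refine ⟨_, ofTerms_eq_filter_add_filter_not isDisplayed L, totalDegree_ofTerms_le fun t ht => ?_,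
    ?_, ?_⟩
  · have := (List.mem_filter.1 ht).2
    simp only [isDisplayed, Bool.not_or, Bool.and_eq_true, Bool.not_eq_true',
      decide_eq_false_iff_not] at this
    exact not_lt.1 this.1
  · have : (Finsupp.single 0 8 + Finsupp.single 2 15 : Fin 3 →₀ ℕ) =
        tripleExponent (8, 0, 15) := by
      ext i
      fin_cases i <;> simp [tripleExponent]
    rw [this]
    refine coeff_ofTerms_eq_zero fun t ht => ?_
    have := (List.mem_filter.1 ht).2
    simp only [isDisplayed, Bool.not_or, Bool.and_eq_true, Bool.not_eq_true',
      decide_eq_false_iff_not] at this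
    exact this.2
  · rw [card_support_ofTerms (hL.sublist (List.filter_sublist.map _))
      fun t ht => h0 t (List.mem_of_mem_filter ht)]
    have := List.length_eq_length_filter_add (l := L) isDisplayed
    omega

/-! ### The implicit equations of the surface and of its half -/

theorem isImplicitEquation_bourTerms :
    IsImplicitEquation bour4Surface
      (MvPolynomial.map (Int.castRingHom ℝ) (ofTerms bourTerms)) := by
  have hz : Finsupp.single 2 25 = tripleExponent (0, 0, 25) := by
    ext i
    fin_cases i <;> simp [tripleExponent]
  have hmem : (1514571848868138319872, 0, 0, 25) ∈ bourTerms := by decide +kernel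
  have hlt : ∀ t ∈ bourTerms, t.2 ≠ (0, 0, 25) → t.2.1 + t.2.2.1 + t.2.2.2 < 25 := by
    decide +kernel
  refine isImplicitEquation_bour4Surface (fun p hp => eval_bourTerms hp) ?_ fun c hc hne => ?_
  · rw [MvPolynomial.coeff_map, hz, coeff_ofTerms nodup_bourTerms hmem]
    norm_num
  · obtain ⟨t, ht, rfl⟩ :=
      exists_mem_of_mem_support_ofTerms (MvPolynomial.support_map_subset _ _ hc)
    rw [degree_tripleExponent]
    refine hlt t ht fun h => hne ?_
    rw [hz, h]

theorem totalDegree_ofTerms_bourTerms : (ofTerms bourTerms).totalDegree = 25 :=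
  totalDegree_ofTerms nodup_bourTerms bourTerms_ne_zero degree_bourTerms_le (by decide +kernel)

-- Carries the relation between `F` and `P` from integer to real coefficients, where the homothety
-- acts.
open MvPolynomial in
theorem map_aeval_two_mul_X (F : MvPolynomial (Fin 3) ℤ) :
    map (Int.castRingHom ℝ) (aeval (fun i => (2 * X i : MvPolynomial (Fin 3) ℤ)) F) =
      aeval (fun i => C 2 * X i : Fin 3 → MvPolynomial (Fin 3) ℝ) (map (Int.castRingHom ℝ) F) := by
  have : (map (Int.castRingHom ℝ)).comp
      (aeval (fun i => (2 * X i : MvPolynomial (Fin 3) ℤ)) :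
        MvPolynomial (Fin 3) ℤ →ₐ[ℤ] MvPolynomial (Fin 3) ℤ).toRingHom =
      (aeval (fun i => C 2 * X i : Fin 3 → MvPolynomial (Fin 3) ℝ) :
        MvPolynomial (Fin 3) ℝ →ₐ[ℝ] MvPolynomial (Fin 3) ℝ).toRingHom.comp
        (map (Int.castRingHom ℝ)) := by
    refine ringHom_ext (fun c => by simp) fun i => ?_
    have h2 : (C 2 : MvPolynomial (Fin 3) ℝ) = 2 := map_ofNat C 2
    simp [h2]
  exact congrArg (fun f => f F) this

open MvPolynomial in
theorem mainTheorem3 :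
    (∃ F P : MvPolynomial (Fin 3) ℤ,
      -- the implicit equation of the surface itself
      IsImplicitEquation bour4Surface (map (Int.castRingHom ℝ) F) ∧
      F.totalDegree = 25 ∧
      F.support.card = 237 ∧
      (∃ R : MvPolynomial (Fin 3) ℤ,
        F = C 1514571848868138319872 * X 2 ^ 25
          - C 9244212944751820800000 * X 0 ^ 4 * X 2 ^ 20
          + C 55465277668510924800000 * X 0 ^ 2 * X 1 ^ 2 * X 2 ^ 20
          - C 9244212944751820800000 * X 1 ^ 4 * X 2 ^ 20
          - C 330069859172352000000000 * X 0 ^ 8 * X 2 ^ 15 + R ∧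
        R.totalDegree ≤ 23 ∧
        R.coeff (Finsupp.single 0 8 + Finsupp.single 2 15) = 0 ∧
        R.support.card = 232) ∧
      -- the same equation after the homothety of ratio `1 / 2`
      C (2 ^ 20) * P = aeval (fun i : Fin 3 => (2 * X i : MvPolynomial (Fin 3) ℤ)) F ∧
      IsImplicitEquation halfBour4Surface (map (Int.castRingHom ℝ) P) ∧
      P.totalDegree = 25 ∧
      P.support.card = 237 ∧
      (∃ R : MvPolynomial (Fin 3) ℤ,
        P = C 48466299163780426235904 * X 2 ^ 25
          - C 147907407116029132800000 * X 0 ^ 4 * X 2 ^ 20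
          + C 887444442696174796800000 * X 0 ^ 2 * X 1 ^ 2 * X 2 ^ 20
          - C 147907407116029132800000 * X 1 ^ 4 * X 2 ^ 20
          - C 2640558873378816000000000 * X 0 ^ 8 * X 2 ^ 15 + R ∧
        R.totalDegree ≤ 23 ∧
        R.coeff (Finsupp.single 0 8 + Finsupp.single 2 15) = 0 ∧
        R.support.card = 232)) ∧
    IsAlgebraicOfDegree bour4Surface 25 := by
  have hnodup := nodup_bourTerms
  have hnodup' : ((bourTerms.map halveTerm).map Prod.snd).Nodup := by
    rwa [map_snd_map_halveTerm]
  have hlen' : (bourTerms.map halveTerm).length = 237 := by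
    rw [List.length_map, length_bourTerms]
  have hscale := C_mul_ofTerms_map_halveTerm halveTerm_bourTerms
  refine ⟨⟨ofTerms bourTerms, ofTerms (bourTerms.map halveTerm), isImplicitEquation_bourTerms,
    totalDegree_ofTerms_bourTerms, ?_, ?_, hscale, ?_, ?_, ?_, ?_⟩, _,
    isImplicitEquation_bourTerms, ?_⟩
  · rw [card_support_ofTerms hnodup bourTerms_ne_zero, length_bourTerms]
  · obtain ⟨R, hR, h⟩ := exists_remainder hnodup bourTerms_ne_zero length_bourTerms
      (by rw [filter_bourTerms]; rfl)
    refine ⟨R, ?_, h⟩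
    rw [hR, filter_bourTerms, ofTerms_leading]
  · refine isImplicitEquation_bourTerms.halfBour4Surface (a := 2 ^ 20) (by norm_num) ?_
    have := congrArg (map (Int.castRingHom ℝ)) hscale
    rw [map_mul, map_C] at this
    rwa [map_aeval_two_mul_X, map_pow, map_ofNat] at this
  · refine totalDegree_ofTerms hnodup' halveTerm_bourTerms_ne_zero ?_ ?_
    · intro s hs
      obtain ⟨t, ht, rfl⟩ := List.mem_map.1 hs
      exact degree_bourTerms_le t ht
    · decide +kernel
  · rw [card_support_ofTerms hnodup' halveTerm_bourTerms_ne_zero, hlen']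
  · obtain ⟨R, hR, h⟩ := exists_remainder hnodup' halveTerm_bourTerms_ne_zero hlen'
      (by rw [filter_halveTerm_bourTerms]; rfl)
    refine ⟨R, ?_, h⟩
    rw [hR, filter_halveTerm_bourTerms, ofTerms_leading]
  · rw [← totalDegree_ofTerms_bourTerms, totalDegree, totalDegree,
      support_map_of_injective _ (RingHom.injective_int _)]
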